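/- Let $\mathbb N=\{1,2,3,\dots\}$, let $\lambda_n>0$ and $q_n\in\mathbb R$ ($n\in\mathbb N$), and let $J$ be the Jacobi operator in $\ell^2(\mathbb N)$ given by $$(Ju)(n)=\lambda_{n-1}u(n-1)+q_nu(n)+\lambda_nu(n+1),\quad n\in\mathbb N,\qquad u(0)=0,$$ on its natural domain $D(J)=\{u\in\ell^2(\mathbb N): Ju\in\ell^2(\mathbb N)\}$. Assume that $J$ is self-adjoint, that $\liminf_{n\to\infty}\lambda_n>0$, and that $(r,s)$, with $-\infty<r<s<\infty$, is a gap in the spectrum of $J$, i.e. $(r,s)\cap\sigma(J)=\emptyset$. Then there exists a constant $\eta>0$ such that for all $\lambda\in(r,s)$ and all real $\delta$ with $|\delta|\le\frac18\sqrt{(\lambda-r)(s-\lambda)}$ the number $\lambda+i\delta$ lies in the resolvent set of $J$, and for all nonempty subsets $A,B\subset\mathbb N$ with $B$ finite and $\max B<\min A$, $$\left\|\chi_A\,(J-(\lambda+i\delta))^{-1}\chi_B\right\|\le 4\max\left\{(\lambda-r)^{-1},(s-\lambda)^{-1}\right\}\exp\left(-\eta\sqrt{(\lambda-r)(s-\lambda)}\sum_{k=\max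 B}^{\min A-1}\frac1{\lambda_k}\right).$$ Here $\chi_A,\chi_B$ denote the operators of multiplication by the characteristic functions of $A$ and $B$, and $\|\cdot\|$ is the operator norm on $\ell^2(\mathbb N)$. -/

import Mathlib

open scoped lp

noncomputable section

namespace JacobiDecay

/-- The Hilbert space `ℓ²(ℕ)` of complex sequences, with `ℕ = {1, 2, 3, …}`. -/
abbrev Seq2 : Type := ℓ²(ℕ+, ℂ)

section UnboundedOperators

variable {H : Type*} [NormedAddCommGroup H] [InnerProductSpace ℂ H]

/-- `R` is a bounded, everywhere defined, two-sided inverse of `T - z : D(T) → H`. -/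
def IsResolventAt (T : H →ₗ.[ℂ] H) (z : ℂ) (R : H →L[ℂ] H) : Prop :=
  (∀ x : H, ∃ h : R x ∈ T.domain, T ⟨R x, h⟩ - z • R x = x) ∧
    ∀ y : T.domain, R (T y - z • (y : H)) = (y : H)

/-- The resolvent set of a (possibly unbounded) linear operator. -/
def resolventSet (T : H →ₗ.[ℂ] H) : Set ℂ := {z | ∃ R : H →L[ℂ] H, IsResolventAt T z R}

/-- The spectrum of a (possibly unbounded) linear operator. -/
def spectrum (T : H →ₗ.[ℂ] H) : Set ℂ := (resolventSet T)ᶜ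

open Classical in
/-- The resolvent `(T - z)⁻¹`; by convention it is `0` when `z` lies in the spectrum. -/
def resolvent (T : H →ₗ.[ℂ] H) (z : ℂ) : H →L[ℂ] H :=
  if h : ∃ R : H →L[ℂ] H, IsResolventAt T z R then h.choose else 0

theorem isResolventAt_resolvent {T : H →ₗ.[ℂ] H} {z : ℂ} (hz : z ∈ resolventSet T) :
    IsResolventAt T z (resolvent T z) := by
  have h : ∃ R : H →L[ℂ] H, IsResolventAt T z R := hz
  rw [resolvent, dif_pos h]
  exact h.choose_spec

theorem IsResolventAt.unique {T : H →ₗ.[ℂ] H} {z : ℂ} {R R' : H →L[ℂ] H}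
    (h : IsResolventAt T z R) (h' : IsResolventAt T z R') : R = R' := by
  ext x
  obtain ⟨hx, e⟩ := h.1 x
  have := h'.2 ⟨R x, hx⟩
  rw [e] at this
  exact this.symm

theorem IsResolventAt.eq_resolvent {T : H →ₗ.[ℂ] H} {z : ℂ} {R : H →L[ℂ] H}
    (h : IsResolventAt T z R) : R = resolvent T z :=
  h.unique (isResolventAt_resolvent ⟨R, h⟩)

end UnboundedOperators

/-- The Jacobi difference expression
`(Ju)(n) = λ_{n-1} u(n-1) + q_n u(n) + λ_n u(n+1)`, with boundary condition `u(0) = 0`. -/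
def jacobiExpr (lam q : ℕ+ → ℝ) (u : ℕ+ → ℂ) (n : ℕ+) : ℂ :=
  (if n = 1 then 0 else (lam (n - 1) : ℂ) * u (n - 1)) + (q n : ℂ) * u n + (lam n : ℂ) * u (n + 1)

theorem jacobiExpr_add (lam q : ℕ+ → ℝ) (u v : ℕ+ → ℂ) :
    jacobiExpr lam q (u + v) = jacobiExpr lam q u + jacobiExpr lam q v := by
  ext n
  simp only [jacobiExpr, Pi.add_apply]
  split_ifs <;> ring

theorem jacobiExpr_smul (lam q : ℕ+ → ℝ) (c : ℂ) (u : ℕ+ → ℂ) :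
    jacobiExpr lam q (c • u) = c • jacobiExpr lam q u := by
  ext n
  simp only [jacobiExpr, Pi.smul_apply, smul_eq_mul]
  split_ifs <;> ring

theorem jacobiExpr_zero (lam q : ℕ+ → ℝ) : jacobiExpr lam q 0 = 0 := by
  ext n
  simp [jacobiExpr]

/-- The Jacobi operator in `ℓ²(ℕ)`: the difference expression on its natural domain
`D(J) = {u ∈ ℓ²(ℕ) : Ju ∈ ℓ²(ℕ)}`. -/
def jacobi (lam q : ℕ+ → ℝ) : Seq2 →ₗ.[ℂ] Seq2 where
  domain :=
    { carrier := {u | Memℓp (jacobiExpr lam q u) 2}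
      zero_mem' := by
        rw [Set.mem_ofPred_eq, lp.coeFn_zero, jacobiExpr_zero]
        exact zero_memℓp
      add_mem' := fun {u v} hu hv => by
        rw [Set.mem_ofPred_eq] at hu hv ⊢
        rw [lp.coeFn_add, jacobiExpr_add]
        exact hu.add hv
      smul_mem' := fun c u hu => by
        rw [Set.mem_ofPred_eq] at hu ⊢
        rw [lp.coeFn_smul, jacobiExpr_smul]
        exact hu.const_smul c }
  toFun :=
    { toFun := fun u => ⟨jacobiExpr lam q (u : Seq2), u.2⟩
      map_add' := fun u v => by
        apply lp.ext
        exact jacobiExpr_add lam q (u : Seq2) (v : Seq2)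
      map_smul' := fun c u => by
        apply lp.ext
        exact jacobiExpr_smul lam q c (u : Seq2) }

theorem mem_jacobi_domain (lam q : ℕ+ → ℝ) (u : Seq2) :
    u ∈ (jacobi lam q).domain ↔ Memℓp (jacobiExpr lam q u) 2 := Iff.rfl

theorem jacobi_apply (lam q : ℕ+ → ℝ) (u : (jacobi lam q).domain) (n : ℕ+) :
    (jacobi lam q u : Seq2) n = jacobiExpr lam q (u : Seq2) n := rfl

theorem norm_indicator_le (A : Set ℕ+) (u : ℕ+ → ℂ) (n : ℕ+) : ‖A.indicator u n‖ ≤ ‖u n‖ :=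
  norm_indicator_le_norm_self u n

theorem memlp_indicator (A : Set ℕ+) (u : Seq2) : Memℓp (A.indicator (u : ℕ+ → ℂ)) 2 :=
  (memℓp_norm_iff.2 (lp.memℓp u)).mono (fun n => norm_indicator_le A u n)

/-- Multiplication by the characteristic function of `A`, as a bounded operator on `ℓ²(ℕ)`. -/
def chi (A : Set ℕ+) : Seq2 →L[ℂ] Seq2 :=
  LinearMap.mkContinuous
    { toFun := fun u => ⟨A.indicator (u : ℕ+ → ℂ), memlp_indicator A u⟩
      map_add' := fun u v => by
        apply lp.ext
        exact Set.indicator_add A (u : ℕ+ → ℂ) (v : ℕ+ → ℂ)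
      map_smul' := fun c u => by
        apply lp.ext
        exact Set.indicator_const_smul A c (u : ℕ+ → ℂ) }
    1
    (fun u => by
      rw [one_mul]
      exact lp.norm_mono (by norm_num) (fun n => norm_indicator_le A u n))

theorem chi_apply (A : Set ℕ+) (u : Seq2) (n : ℕ+) :
    (chi A u : Seq2) n = A.indicator (u : ℕ+ → ℂ) n := rfl

end JacobiDecay

end

noncomputable section

namespace JacobiDecay

/-! ### Resolvents and spectral gaps of self-adjoint operators. -/

section UnboundedOperators

variable {H : Type*} [NormedAddCommGroup H] [InnerProductSpace ℂ H]

/-! This is a Combes–Thomas argument adapted to the edges of the gap. Let `D = √((l - r)(s - l))`,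
let `m = min (l - r) (s - l)`, and let `c > 0` bound all `λ_n` from below. Conjugating `J` by `e^F`,
where `F` grows by `ε / λ_k` per step and `ε = ηD`, adds a self-adjoint term of order `ε² / c` and a
skew-adjoint term of order `ε` (`jacobi_conj_exp`).

Near an edge `D` is much larger than `m`, so the skew term cannot be treated as small against the
distance to the spectrum. But the gap makes the form of `(J - r)(J - s)` nonnegative
(`gap_norm_le`), and a skew term drops out of `Re ⟪f, ·⟫`; hence skew perturbations of size `D`,
among them `iδ`, are harmless (`half_min_mul_norm_le`). The self-adjoint term must be `O(m)`, and it
is, because `D² ≤ m (s - r)`. The resulting lower bound for the conjugated operator gives the decay,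
since `F` vanishes on `B` and is maximal on `A`. -/

theorem IsResolventAt.sub_eq_smul {T : H →ₗ.[ℂ] H} {z w : ℂ} {R S : H →L[ℂ] H}
    (hR : IsResolventAt T z R) (hS : IsResolventAt T w S) : R - S = (z - w) • (R * S) := by
  ext x
  obtain ⟨h, e⟩ := hS.1 x
  have h1 := hR.2 ⟨S x, h⟩
  have h2 : T ⟨S x, h⟩ - z • S x = x - (z - w) • S x := by
    rw [sub_eq_iff_eq_add] at e
    rw [e]; module
  rw [h2, map_sub, map_smul] at h1
  change R x - S x = (z - w) • R (S x)
  simp only at h1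
  rw [sub_eq_iff_eq_add] at h1
  rw [h1]
  module

/-- The resolvent identity, in both orders, makes `1 + (w - z) R` the inverse of `1 - (w - z) S`. -/
theorem IsResolventAt.notMem_spectrum {T : H →ₗ.[ℂ] H} {z w : ℂ} {S R : H →L[ℂ] H}
    (hS : IsResolventAt T z S) (hR : IsResolventAt T w R) (hzw : w ≠ z) :
    (w - z)⁻¹ ∉ _root_.spectrum ℂ S := by
  have hne : w - z ≠ 0 := sub_ne_zero.2 hzw
  have e1 : R = S + (w - z) • (R * S) := by rw [← hR.sub_eq_smul hS]; abel
  have e2 : R = S + (w - z) • (S * R) := by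
    have := hS.sub_eq_smul hR
    rw [← neg_sub w z, neg_smul] at this
    rw [← sub_eq_iff_eq_add', ← neg_sub S R, this, neg_neg]
  rw [spectrum.notMem_iff, Algebra.algebraMap_eq_smul_one]
  refine isUnit_iff_exists.2 ⟨(w - z) • (1 + (w - z) • R), ?_, ?_⟩
  · rw [sub_mul, smul_mul_smul_comm, inv_mul_cancel₀ hne, one_smul, one_mul, mul_smul_comm, mul_add,
      mul_one, mul_smul_comm, ← e2]
    abel
  · rw [mul_sub, smul_mul_smul_comm, mul_inv_cancel₀ hne, one_smul, mul_one, smul_mul_assoc, add_mul,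
      one_mul, smul_mul_assoc, ← e1]
    abel

/-- On the domain, `T - w = (1 - (w - z) S)(T - z)`. -/
theorem IsResolventAt.mem_resolventSet {T : H →ₗ.[ℂ] H} {z w : ℂ} {S : H →L[ℂ] H}
    (hS : IsResolventAt T z S) (hu : IsUnit (1 - (w - z) • S)) : w ∈ resolventSet T := by
  obtain ⟨V, h1, h2⟩ := isUnit_iff_exists.1 hu
  refine ⟨S * V, fun x => ?_, fun y => ?_⟩
  · obtain ⟨h, e⟩ := hS.1 (V x)
    refine ⟨h, ?_⟩
    have h3 : V x - (w - z) • S (V x) = x := DFunLike.congr_fun h1 x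
    change T ⟨S (V x), h⟩ - w • S (V x) = x
    rw [sub_eq_iff_eq_add] at e
    rw [e]
    refine Eq.trans ?_ h3
    module
  · have h3 : V ((T y - z • (y : H)) - (w - z) • S (T y - z • (y : H))) = T y - z • (y : H) :=
      DFunLike.congr_fun h2 _
    have h4 : (T y - z • (y : H)) - (w - z) • S (T y - z • (y : H)) = T y - w • (y : H) := by
      rw [hS.2 y]; module
    change S (V _) = _
    rw [← h4, h3, hS.2 y]

variable [CompleteSpace H]

theorem isFormalAdjoint_of_isSelfAdjoint {T : H →ₗ.[ℂ] H} (hT : IsSelfAdjoint T) :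
    T.IsFormalAdjoint T := by
  have h := LinearPMap.adjoint_isFormalAdjoint hT.dense_domain
  rwa [LinearPMap.isSelfAdjoint_def.1 hT] at h

theorem IsResolventAt.isSelfAdjoint {T : H →ₗ.[ℂ] H} (hT : IsSelfAdjoint T) {c : ℝ} {S : H →L[ℂ] H}
    (hS : IsResolventAt T c S) : IsSelfAdjoint S := by
  rw [ContinuousLinearMap.isSelfAdjoint_iff_isSymmetric]
  intro x y
  obtain ⟨hx, ex⟩ := hS.1 x
  obtain ⟨hy, ey⟩ := hS.1 y
  have h := isFormalAdjoint_of_isSelfAdjoint hT ⟨S x, hx⟩ ⟨S y, hy⟩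
  change inner ℂ (S x) y = inner ℂ x (S y)
  nth_rewrite 2 [← ex]
  nth_rewrite 1 [← ey]
  simp only [inner_sub_left, inner_sub_right, inner_smul_left, inner_smul_right, Complex.conj_ofReal]
  rw [h]

theorem mem_resolventSet_of_real {T : H →ₗ.[ℂ] H} (hT : IsSelfAdjoint T) {l : ℝ}
    (hl : (l : ℂ) ∈ resolventSet T) (δ : ℝ) : (l : ℂ) + δ * Complex.I ∈ resolventSet T := by
  obtain ⟨S, hS⟩ := hl
  refine hS.mem_resolventSet ?_
  rw [add_sub_cancel_left]
  rcases eq_or_ne δ 0 with rfl | hδ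
  · simp
  have hne : (δ : ℂ) * Complex.I ≠ 0 := by simp [hδ]
  have hmem : ((δ : ℂ) * Complex.I)⁻¹ ∉ _root_.spectrum ℂ S := by
    intro hm
    have h1 := (hS.isSelfAdjoint hT).mem_spectrum_eq_re hm
    have h2 := congrArg Complex.im h1
    simp [hδ] at h2
  rw [spectrum.notMem_iff, Algebra.algebraMap_eq_smul_one] at hmem
  have := hmem.smul (Units.mk0 _ hne)
  rwa [Units.smul_mk0, smul_sub, smul_smul, mul_inv_cancel₀ hne, one_smul] at this

/-- The resolvent `S` at the midpoint is self-adjoint, so its norm is its spectral radius. A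
spectral value `t` of `S` with `|t| > 2 / (s - r)` would put `(r + s) / 2 + 1 / t` into the gap. -/
theorem gap_norm_le {T : H →ₗ.[ℂ] H} (hT : IsSelfAdjoint T) {r s : ℝ} (hrs : r < s)
    (hgap : ∀ x ∈ Set.Ioo r s, (x : ℂ) ∉ spectrum T) (f : T.domain) :
    (s - r) / 2 * ‖(f : H)‖ ≤ ‖T f - (((r + s) / 2 : ℝ) : ℂ) • (f : H)‖ := by
  have hres : ∀ x ∈ Set.Ioo r s, (x : ℂ) ∈ resolventSet T := fun x hx => by
    simpa [spectrum] using hgap x hx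
  obtain ⟨S, hS⟩ := hres ((r + s) / 2) ⟨by linarith, by linarith⟩
  have hSsa := hS.isSelfAdjoint hT
  have hh : 0 < (s - r) / 2 := by linarith
  have hnorm : ‖S‖ ≤ ((s - r) / 2)⁻¹ := by
    have h1 := hSsa.spectralRadius_eq_nnnorm
    have h2 : spectralRadius ℂ S ≤ ENNReal.ofReal ((s - r) / 2)⁻¹ := by
      refine iSup₂_le fun k hk => ?_
      rw [← enorm_eq_nnnorm, ← ofReal_norm]
      refine ENNReal.ofReal_le_ofReal ?_
      by_contra! hlt
      have hk0 : 0 < ‖k‖ := (inv_pos.2 hh).trans hlt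
      have hkr := hSsa.mem_spectrum_eq_re hk
      set t := k.re
      have ht : ‖k‖ = |t| := by rw [hkr]; simp
      have ht0 : t ≠ 0 := by rw [ht] at hk0; exact abs_pos.1 hk0
      have htl : |t⁻¹| < (s - r) / 2 := by
        rw [abs_inv, ← ht]; exact inv_lt_of_inv_lt₀ hh hlt
      obtain ⟨R, hR⟩ := hres ((r + s) / 2 + t⁻¹)
        ⟨by linarith [(abs_lt.1 htl).1], by linarith [(abs_lt.1 htl).2]⟩
      refine hS.notMem_spectrum hR ?_ ?_
      · simpa using ht0
      · convert hk using 1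
        rw [hkr]; push_cast; simp
    rw [h1, ← enorm_eq_nnnorm, ← ofReal_norm] at h2
    exact (ENNReal.ofReal_le_ofReal_iff (inv_pos.2 hh).le).1 h2
  have h3 := hS.2 f
  have h4 := S.le_of_opNorm_le hnorm (T f - (((r + s) / 2 : ℝ) : ℂ) • (f : H))
  rw [h3] at h4
  rwa [inv_mul_eq_div, le_div_iff₀' hh] at h4

end UnboundedOperators

/-! ### Stability of the gap under skew perturbations. -/

variable {H : Type*} [NormedAddCommGroup H] [InnerProductSpace ℂ H]

/-- If the quadratic form of `(T - r)(T - s)` is nonnegative at `f`, where `w = (T - l) f`, then a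
perturbation `p` of relative size at most `√((l - r)(s - l)) / 4` with `Re ⟪f, p⟫ = 0` does not
close the gap at `l`. -/
theorem half_min_mul_norm_le {l r s : ℝ} (hr : r < l) (hs : l < s) {f w p : H}
    (hp : (inner ℂ f p).re = 0)
    (hgap : (s - r) / 2 * ‖f‖ ≤ ‖w + (((l - (r + s) / 2 : ℝ)) : ℂ) • f‖)
    (hpn : ‖p‖ ≤ Real.sqrt ((l - r) * (s - l)) / 4 * ‖f‖) :
    min (l - r) (s - l) / 2 * ‖f‖ ≤ ‖w + p‖ := by
  obtain ⟨a, ha⟩ : ∃ a, a = l - r := ⟨_, rfl⟩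
  obtain ⟨b, hb⟩ : ∃ b, b = s - l := ⟨_, rfl⟩
  have ha0 : 0 < a := by linarith
  have hb0 : 0 < b := by linarith
  rw [show s - r = a + b by linarith, show l - (r + s) / 2 = (a - b) / 2 by linarith] at hgap
  rw [← ha, ← hb] at hpn ⊢
  set N := ‖f‖ with hN
  set W := ‖w‖ with hW
  set G := ‖w + p‖ with hG
  set D := Real.sqrt (a * b) with hD
  set ρ := (inner ℂ f (w + p)).re with hρ
  have hDsq : D ^ 2 = a * b := Real.sq_sqrt (by positivity)
  have hD0 : 0 < D := Real.sqrt_pos.2 (by positivity)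
  have hρ' : |ρ| ≤ N * G := (Complex.abs_re_le_norm _).trans (norm_inner_le_norm _ _)
  have hWle : W ≤ G + D / 4 * N := by
    have : W ≤ G + ‖p‖ := by
      simpa [hG, hW] using norm_sub_le (w + p) p
    linarith
  -- `Re ⟪f, w⟫` equals `ρ` because `p` contributes nothing; so the cross term is controlled by `G`
  -- rather than by `W`.
  have hexp : ‖w + (((a - b) / 2 : ℝ) : ℂ) • f‖ ^ 2 = W ^ 2 + (a - b) * ρ + ((a - b) / 2) ^ 2 * N ^ 2 := by
    rw [@norm_add_sq ℂ, inner_smul_right, norm_smul, Complex.norm_real, mul_pow, Real.norm_eq_abs,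
      sq_abs, hρ, inner_add_right, Complex.add_re, hp, add_zero, ← inner_conj_symm w f]
    simp only [RCLike.re_eq_complex_re, Complex.re_ofReal_mul, Complex.conj_re]
    ring
  have hsq : a * b * N ^ 2 ≤ W ^ 2 + (a - b) * ρ := by
    have := pow_le_pow_left₀ (by positivity) hgap 2
    rw [hexp] at this
    nlinarith
  have hN0 : 0 ≤ N := norm_nonneg _
  have hG0 : 0 ≤ G := norm_nonneg _
  have hW0 : 0 ≤ W := norm_nonneg _
  by_contra! hlt
  have hNpos : 0 < N := by
    rcases hN0.eq_or_lt with h | h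
    · rw [← h] at hlt; linarith
    · exact h
  obtain ⟨m, M, hm0, hmM, hmin, hprod, habs⟩ : ∃ m M, 0 < m ∧ m ≤ M ∧ min a b = m ∧ m * M = a * b ∧
      |a - b| = M - m := by
    rcases le_total a b with h | h
    · exact ⟨a, b, ha0, h, min_eq_left h, rfl, by rw [abs_of_nonpos (by linarith)]; ring⟩
    · exact ⟨b, a, hb0, h, min_eq_right h, mul_comm _ _, abs_of_nonneg (by linarith)⟩
  rw [hmin] at hlt
  have hmD : m ≤ D := Real.le_sqrt_of_sq_le (by nlinarith)
  have h1 : (a - b) * ρ ≤ (M - m) * (N * (m / 2 * N)) := by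
    refine (le_abs_self _).trans ?_
    rw [abs_mul, habs]
    exact mul_le_mul_of_nonneg_left (hρ'.trans (by gcongr)) (by linarith)
  have h2 : W ^ 2 ≤ ((m / 2 + D / 4) * N) ^ 2 := by
    refine pow_le_pow_left₀ hW0 ?_ 2
    linarith
  have h3 : D ^ 2 * N ^ 2 ≤ 13 / 16 * D ^ 2 * N ^ 2 := by
    -- With `m * M = D²` the left side is `9/16 D² + m D / 4 - m² / 4`, and `m ≤ D`. A factor below
    -- `1` suffices for the contradiction.
    have h4 : (m / 2 + D / 4) ^ 2 + (M - m) * (m / 2) ≤ 13 / 16 * D ^ 2 := by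
      have h5 : m * D ≤ D * D := mul_le_mul_of_nonneg_right hmD hD0.le
      linear_combination (1 / 4) * h5 - (1 / 2) * hDsq + (1 / 2) * hprod + (1 / 4) * sq_nonneg m
    have h6 := mul_le_mul_of_nonneg_right h4 (sq_nonneg N)
    rw [hDsq]
    rw [hDsq] at h6
    linear_combination hsq + h1 + h2 + h6
  have : 0 < D ^ 2 * N ^ 2 := by positivity
  linarith

/-! ### Weighted shifts on `ℓ²` and their adjoints. -/

section

theorem memlp_two_iff {f : ℕ+ → ℂ} : Memℓp f 2 ↔ Summable fun n => ‖f n‖ ^ 2 := by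
  rw [memℓp_gen_iff (by norm_num)]
  simp

theorem norm_sq_eq_tsum (f : Seq2) : ‖f‖ ^ 2 = ∑' n, ‖f n‖ ^ 2 := by
  have := lp.norm_rpow_eq_tsum (p := 2) (by norm_num) f
  simpa using this

theorem summable_norm_sq (f : Seq2) : Summable fun n => ‖f n‖ ^ 2 :=
  memlp_two_iff.1 (lp.memℓp f)

theorem summable_norm_sq_succ (f : Seq2) : Summable fun n : ℕ+ => ‖f (n + 1)‖ ^ 2 :=
  (summable_norm_sq f).comp_injective (add_left_injective 1)

theorem norm_mul_succ_sq_le {c : ℕ+ → ℝ} {C : ℝ} (hc : ∀ n, |c n| ≤ C) (f : Seq2) (n : ℕ+) :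
    ‖(c n : ℂ) * f (n + 1)‖ ^ 2 ≤ C ^ 2 * ‖f (n + 1)‖ ^ 2 := by
  rw [norm_mul, mul_pow, Complex.norm_real, Real.norm_eq_abs]
  gcongr
  exact hc n

/-- The weighted backward shift `u ↦ (c_n u(n+1))_n` with bounded real weights. -/
def backShift (c : ℕ+ → ℝ) (C : ℝ) (hc : ∀ n, |c n| ≤ C) : Seq2 →L[ℂ] Seq2 :=
  LinearMap.mkContinuous
    { toFun := fun u => ⟨fun n => (c n : ℂ) * u (n + 1), memlp_two_iff.2 <|
        Summable.of_nonneg_of_le (fun _ => by positivity) (norm_mul_succ_sq_le hc u)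
          ((summable_norm_sq_succ u).mul_left (C ^ 2))⟩
      map_add' := fun u v => by
        ext n
        exact mul_add _ _ _
      map_smul' := fun k u => by
        ext n
        simp [mul_left_comm] }
    C
    (fun u => by
      have hC : 0 ≤ C := (abs_nonneg _).trans (hc 1)
      refine le_of_sq_le_sq ?_ (by positivity)
      rw [norm_sq_eq_tsum, mul_pow, norm_sq_eq_tsum u, ← tsum_mul_left]
      refine (Summable.tsum_le_tsum (norm_mul_succ_sq_le hc u) ?_
        ((summable_norm_sq_succ u).mul_left (C ^ 2))).trans ?_
      · exact Summable.of_nonneg_of_le (fun _ => by positivity) (norm_mul_succ_sq_le hc u)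
          ((summable_norm_sq_succ u).mul_left (C ^ 2))
      · exact tsum_comp_le_tsum_of_inj ((summable_norm_sq u).mul_left (C ^ 2))
          (fun _ => by positivity) (add_left_injective 1))

variable {c : ℕ+ → ℝ} {C : ℝ} (hc : ∀ n, |c n| ≤ C)

theorem backShift_apply (u : Seq2) (n : ℕ+) : backShift c C hc u n = (c n : ℂ) * u (n + 1) := rfl

theorem norm_backShift_le : ‖backShift c C hc‖ ≤ C :=
  LinearMap.mkContinuous_norm_le _ ((abs_nonneg _).trans (hc 1)) _

theorem adjoint_backShift_apply (u : Seq2) (n : ℕ+) :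
    (ContinuousLinearMap.adjoint (backShift c C hc) u) n =
      if n = 1 then 0 else (c (n - 1) : ℂ) * u (n - 1) := by
  have h1 : (ContinuousLinearMap.adjoint (backShift c C hc) u) n =
      inner ℂ (backShift c C hc (lp.single 2 n 1)) u := by
    rw [← ContinuousLinearMap.adjoint_inner_right, lp.inner_single_left]
    simp
  have h2 : ∀ m, backShift c C hc (lp.single 2 n 1) m = if m + 1 = n then (c m : ℂ) else 0 := by
    intro m
    rw [backShift_apply]
    split_ifs with h
    · rw [h]; simp
    · simp [h]
  rw [h1]
  split_ifs with hn
  · have : backShift c C hc (lp.single 2 n 1) = 0 := by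
      ext m
      rw [h2, if_neg (by rw [hn]; exact (PNat.lt_add_left 1 m).ne')]; rfl
    rw [this, inner_zero_left]
  · have : backShift c C hc (lp.single 2 n 1) = lp.single 2 (n - 1) (c (n - 1) : ℂ) := by
      ext m
      rw [h2]
      have hn1 : n - 1 + 1 = n := PNat.sub_add_of_lt (lt_of_le_of_ne (one_le) (Ne.symm hn))
      by_cases hm : m = n - 1
      · rw [hm, if_pos hn1]; simp
      · rw [if_neg, lp.single_apply_ne _ _ _ hm]
        intro h
        exact hm (add_right_cancel (h.trans hn1.symm))
    rw [this, lp.inner_single_left]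
    simp [mul_comm]

end

/-! ### Conjugation by an exponential weight. -/

open ContinuousLinearMap (adjoint)

theorem exp_le_one_add_two_mul {x : ℝ} (hx0 : 0 ≤ x) (hx1 : x ≤ 1) : Real.exp x ≤ 1 + 2 * x := by
  have h := Real.abs_exp_sub_one_le (x := x) (by rwa [abs_of_nonneg hx0])
  rw [abs_of_nonneg hx0] at h
  linarith [le_abs_self (Real.exp x - 1)]

theorem cosh_sub_one_le_sq {x : ℝ} (hx0 : 0 ≤ x) (hx1 : x ≤ 1) : Real.cosh x - 1 ≤ x ^ 2 := by
  have h := exp_le_one_add_two_mul (x := x ^ 2 / 2) (by positivity) (by nlinarith)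
  linarith [Real.cosh_le_exp_half_sq x]

theorem sinh_le_two_mul {x : ℝ} (hx0 : 0 ≤ x) (hx1 : x ≤ 1) : Real.sinh x ≤ 2 * x := by
  have h := Real.cosh_add_sinh x
  linarith [exp_le_one_add_two_mul hx0 hx1, Real.one_le_cosh x]

/-- If the increment of the weight at `n` is at most `ε / μ`, the symmetric part of the conjugated
off-diagonal entry `μ` is small of second order. -/
theorem abs_mul_cosh_sub_one_le {μ c ε x : ℝ} (hc : 0 < c) (hcμ : c ≤ μ) (hx0 : 0 ≤ x)
    (hx : x ≤ ε / μ) (hε : ε ≤ c) : |μ * (Real.cosh x - 1)| ≤ ε ^ 2 / c := by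
  have hμ : 0 < μ := hc.trans_le hcμ
  have hx1 : x ≤ 1 := hx.trans ((div_le_one hμ).2 (hε.trans hcμ))
  rw [abs_of_nonneg (mul_nonneg hμ.le (sub_nonneg.2 (Real.one_le_cosh x)))]
  calc μ * (Real.cosh x - 1) ≤ μ * (ε / μ) ^ 2 := by
        gcongr
        exact (cosh_sub_one_le_sq hx0 hx1).trans (by gcongr)
    _ = ε ^ 2 / μ := by field_simp
    _ ≤ ε ^ 2 / c := by gcongr

/-- The skew part is only of first order in `ε`, which is affordable because it is compared with
`D`, not with `m`. -/
theorem abs_mul_sinh_le {μ c ε x : ℝ} (hc : 0 < c) (hcμ : c ≤ μ) (hx0 : 0 ≤ x)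
    (hx : x ≤ ε / μ) (hε : ε ≤ c) : |μ * Real.sinh x| ≤ 2 * ε := by
  have hμ : 0 < μ := hc.trans_le hcμ
  have hx1 : x ≤ 1 := hx.trans ((div_le_one hμ).2 (hε.trans hcμ))
  rw [abs_of_nonneg (mul_nonneg hμ.le (Real.sinh_nonneg_iff.2 hx0))]
  calc μ * Real.sinh x ≤ μ * (2 * (ε / μ)) := by
        gcongr
        exact (sinh_le_two_mul hx0 hx1).trans (by gcongr)
    _ = 2 * ε := by field_simp

theorem jacobiExpr_one (lam q : ℕ+ → ℝ) (u : ℕ+ → ℂ) :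
    jacobiExpr lam q u 1 = (q 1 : ℂ) * u 1 + (lam 1 : ℂ) * u (1 + 1) := by
  simp [jacobiExpr]

theorem jacobiExpr_succ (lam q : ℕ+ → ℝ) (u : ℕ+ → ℂ) (n : ℕ+) :
    jacobiExpr lam q u (n + 1) =
      (lam n : ℂ) * u n + (q (n + 1) : ℂ) * u (n + 1) + (lam (n + 1) : ℂ) * u (n + 1 + 1) := by
  simp [jacobiExpr, (PNat.lt_add_left 1 n).ne']

theorem adjoint_backShift_one {c : ℕ+ → ℝ} {C : ℝ} (hc : ∀ n, |c n| ≤ C) (u : Seq2) :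
    (adjoint (backShift c C hc) u) 1 = 0 := by
  rw [adjoint_backShift_apply, if_pos rfl]

theorem adjoint_backShift_succ {c : ℕ+ → ℝ} {C : ℝ} (hc : ∀ n, |c n| ≤ C) (u : Seq2) (n : ℕ+) :
    (adjoint (backShift c C hc) u) (n + 1) = (c n : ℂ) * u n := by
  simp [adjoint_backShift_apply, (PNat.lt_add_left 1 n).ne']

/-- Conjugation of the Jacobi operator by the weight `e^F`. -/
theorem jacobi_conj_exp (lam q : ℕ+ → ℝ) (F : ℕ+ → ℝ) {K S : ℝ}
    (hK : ∀ n, |lam n * (Real.cosh (F (n + 1) - F n) - 1)| ≤ K)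
    (hS : ∀ n, |lam n * Real.sinh (F (n + 1) - F n)| ≤ S) {u : ℕ+ → ℂ} {f g : Seq2}
    (hf : ∀ n, f n = (Real.exp (F n) : ℂ) * u n)
    (hg : ∀ n, g n = (Real.exp (F n) : ℂ) * jacobiExpr lam q u n) :
    ∃ h : f ∈ (jacobi lam q).domain,
      jacobi lam q ⟨f, h⟩ + (backShift _ K hK f + adjoint (backShift _ K hK) f) +
        (adjoint (backShift _ S hS) f - backShift _ S hS f) = g := by
  -- With `d = F (n + 1) - F n`, the conjugated entries are `λ e^{-d}` above the diagonal and `λ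
  -- e^{d}` below. The even part `λ cosh d` is symmetric, the odd part `∓λ sinh d` is skew.
  have hup : ∀ n, (lam n : ℂ) * f (n + 1) + backShift _ K hK f n - backShift _ S hS f n =
      (Real.exp (F n) : ℂ) * ((lam n : ℂ) * u (n + 1)) := by
    intro n
    have h1 : lam n + lam n * (Real.cosh (F (n + 1) - F n) - 1) - lam n * Real.sinh (F (n + 1) - F n)
        = lam n * Real.exp (-(F (n + 1) - F n)) := by
      rw [← Real.cosh_sub_sinh]; ring
    have h2 : Real.exp (-(F (n + 1) - F n)) * Real.exp (F (n + 1)) = Real.exp (F n) := by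
      rw [← Real.exp_add]; congr 1; ring
    rw [backShift_apply, backShift_apply, ← add_mul, ← sub_mul]
    norm_cast
    rw [h1, hf, ← h2]
    push_cast
    ring
  have hlow : ∀ n, (lam n : ℂ) * f n + adjoint (backShift _ K hK) f (n + 1) +
      adjoint (backShift _ S hS) f (n + 1) = (Real.exp (F (n + 1)) : ℂ) * ((lam n : ℂ) * u n) := by
    intro n
    have h1 : lam n + lam n * (Real.cosh (F (n + 1) - F n) - 1) + lam n * Real.sinh (F (n + 1) - F n)
        = lam n * Real.exp (F (n + 1) - F n) := by
      rw [← Real.cosh_add_sinh]; ring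
    have h2 : Real.exp (F (n + 1) - F n) * Real.exp (F n) = Real.exp (F (n + 1)) := by
      rw [← Real.exp_add]; congr 1; ring
    rw [adjoint_backShift_succ, adjoint_backShift_succ, ← add_mul, ← add_mul]
    norm_cast
    rw [h1, hf, ← h2]
    push_cast
    ring
  have key : ∀ n, jacobiExpr lam q f n + (backShift _ K hK f n + adjoint (backShift _ K hK) f n) +
        (adjoint (backShift _ S hS) f n - backShift _ S hS f n) = g n := by
    intro n
    induction n using PNat.recOn with
    | one =>
      rw [hg, jacobiExpr_one, jacobiExpr_one, adjoint_backShift_one, adjoint_backShift_one, mul_add,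
        ← hup, hf 1]
      ring
    | succ n =>
      rw [hg, jacobiExpr_succ, jacobiExpr_succ, mul_add, mul_add, ← hup, ← hlow, hf (n + 1)]
      ring
  -- The domain is the natural one, so it is enough that `Jf` differs from `g` by bounded operators
  -- applied to `f`.
  have hmem : f ∈ (jacobi lam q).domain := by
    rw [mem_jacobi_domain]
    have : jacobiExpr lam q f = ⇑(g - (backShift _ K hK f + adjoint (backShift _ K hK) f) -
        (adjoint (backShift _ S hS) f - backShift _ S hS f)) := by
      ext n
      change _ = g n - (backShift _ K hK f n + adjoint (backShift _ K hK) f n) -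
        (adjoint (backShift _ S hS) f n - backShift _ S hS f n)
      rw [← key]
      ring
    rw [this]
    exact lp.memℓp _
  refine ⟨hmem, ?_⟩
  ext n
  exact key n

/-! ### Lower bound for the conjugated operator. -/

theorem inner_adjoint_sub_re {H : Type*} [NormedAddCommGroup H] [InnerProductSpace ℂ H]
    [CompleteSpace H] (V : H →L[ℂ] H) (f : H) : (inner ℂ f (adjoint V f - V f)).re = 0 := by
  rw [inner_sub_right, ContinuousLinearMap.adjoint_inner_right, Complex.sub_re,
    ← inner_conj_symm (V f) f, Complex.conj_re, sub_self]

/-- The a priori estimate for a conjugated self-adjoint operator in a spectral gap. -/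
theorem quarter_min_mul_norm_le {H : Type*} [NormedAddCommGroup H] [InnerProductSpace ℂ H]
    [CompleteSpace H] {T : H →ₗ.[ℂ] H} (hT : IsSelfAdjoint T) {r s l δ : ℝ} (hr : r < l) (hs : l < s)
    (hgap : ∀ x ∈ Set.Ioo r s, (x : ℂ) ∉ spectrum T)
    (hδ : |δ| ≤ Real.sqrt ((l - r) * (s - l)) / 8) {V U : H →L[ℂ] H}
    (hV : ‖V‖ ≤ min (l - r) (s - l) / 8) (hU : ‖U‖ ≤ Real.sqrt ((l - r) * (s - l)) / 16)
    (f : T.domain) :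
    min (l - r) (s - l) / 4 * ‖(f : H)‖ ≤
      ‖T f + (V f + adjoint V f) + (adjoint U f - U f) - ((l : ℂ) + δ * Complex.I) • (f : H)‖ := by
  -- All skew terms go into `p`, with budget `D/8 + 2 · D/16 = D/4`. The symmetric term costs `2 ·
  -- m/8`, leaving `m/4` of the `m/2`.
  set p : H := -(((δ : ℂ) * Complex.I) • (f : H)) + (adjoint U f - U f) with hp
  have hre : (inner ℂ (f : H) p).re = 0 := by
    rw [hp, inner_add_right, Complex.add_re, inner_adjoint_sub_re, inner_neg_right, inner_smul_right,
      inner_self_eq_norm_sq_to_K]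
    simp [← Complex.ofReal_pow]
  have hpn : ‖p‖ ≤ Real.sqrt ((l - r) * (s - l)) / 4 * ‖(f : H)‖ := by
    have h1 : ‖((δ : ℂ) * Complex.I) • (f : H)‖ ≤ Real.sqrt ((l - r) * (s - l)) / 8 * ‖(f : H)‖ := by
      rw [norm_smul]
      simp only [norm_mul, Complex.norm_real, Complex.norm_I, mul_one, Real.norm_eq_abs]
      gcongr
    have h2 := U.le_of_opNorm_le hU f
    have h3 := (adjoint U).le_of_opNorm_le ((LinearIsometryEquiv.norm_map _ _).trans_le hU) (f : H)
    have h4 := norm_add_le (-(((δ : ℂ) * Complex.I) • (f : H))) (adjoint U f - U f)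
    have h5 := norm_sub_le (adjoint U (f : H)) (U f)
    rw [norm_neg] at h4
    linarith
  have hg : (s - r) / 2 * ‖(f : H)‖ ≤
      ‖(T f - (l : ℂ) • (f : H)) + (((l - (r + s) / 2 : ℝ)) : ℂ) • (f : H)‖ := by
    convert gap_norm_le hT (hr.trans hs) hgap f using 2
    push_cast
    module
  have hmain := half_min_mul_norm_le hr hs hre hg hpn
  have h1 := V.le_of_opNorm_le hV f
  have h2 := (adjoint V).le_of_opNorm_le ((LinearIsometryEquiv.norm_map _ _).trans_le hV) (f : H)
  have h3 := norm_add_le (V (f : H)) (adjoint V f)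
  have h4 : T f - (l : ℂ) • (f : H) + p =
      (T f + (V f + adjoint V f) + (adjoint U f - U f) - ((l : ℂ) + δ * Complex.I) • (f : H)) -
        (V f + adjoint V f) := by
    rw [hp]; module
  rw [h4] at hmain
  have h5 := norm_sub_le
    (T f + (V f + adjoint V f) + (adjoint U f - U f) - ((l : ℂ) + δ * Complex.I) • (f : H))
    (V f + adjoint V f)
  linarith

/-! ### The Combes–Thomas weight and the decay estimate. -/

theorem memlp_exp_mul {F : ℕ+ → ℝ} {M : ℝ} (hF : ∀ n, F n ≤ M) (u : Seq2) :
    Memℓp (fun n => (Real.exp (F n) : ℂ) * u n) 2 := by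
  refine memlp_two_iff.2 (Summable.of_nonneg_of_le (fun _ => by positivity) (fun n => ?_)
    ((summable_norm_sq u).mul_left (Real.exp M ^ 2)))
  rw [norm_mul, mul_pow, Complex.norm_real, Real.norm_eq_abs, Real.abs_exp]
  gcongr
  exact hF n

theorem norm_chi_le (A : Set ℕ+) (u : Seq2) : ‖chi A u‖ ≤ ‖u‖ :=
  lp.norm_mono (by norm_num) (fun n => norm_indicator_le A u n)

theorem exists_pos_le_of_liminf_pos {lam : ℕ+ → ℝ} (hlam : ∀ n, 0 < lam n)
    (hliminf : 0 < Filter.liminf (fun n : ℕ+ => (lam n : EReal)) Filter.atTop) :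
    ∃ c : ℝ, 0 < c ∧ ∀ n, c ≤ lam n := by
  obtain ⟨x, hx0, hx⟩ := EReal.lt_iff_exists_real_btwn.1 hliminf
  obtain ⟨N, hN⟩ := Filter.eventually_atTop.1 (Filter.eventually_lt_of_lt_liminf hx)
  obtain ⟨k, -, hk⟩ := Finset.exists_min_image (Finset.Icc 1 N) lam ⟨1, by simp⟩
  refine ⟨min x (lam k), lt_min (by exact_mod_cast hx0) (hlam k), fun n => ?_⟩
  rcases le_total n N with h | h
  · exact (min_le_right _ _).trans (hk n (Finset.mem_Icc.2 ⟨one_le, h⟩))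
  · exact (min_le_left _ _).trans (by exact_mod_cast (hN n h).le)

/-- The Combes–Thomas weight: it vanishes up to `b`, is constant from `a` on, and increases by
`ε / λ_k` in between. -/
def weight (lam : ℕ+ → ℝ) (ε : ℝ) (a b n : ℕ+) : ℝ :=
  ε * ∑ k ∈ (Finset.Ico b a).filter (· < n), 1 / lam k

section Weight

variable {lam : ℕ+ → ℝ} {ε : ℝ} (a b : ℕ+)

theorem weight_of_le {n : ℕ+} (h : n ≤ b) : weight lam ε a b n = 0 := by
  rw [weight, Finset.filter_false_of_mem, Finset.sum_empty, mul_zero]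
  intro k hk
  exact not_lt.2 (h.trans (Finset.mem_Ico.1 hk).1)

theorem weight_of_ge {n : ℕ+} (h : a ≤ n) :
    weight lam ε a b n = ε * ∑ k ∈ Finset.Ico b a, 1 / lam k := by
  rw [weight, Finset.filter_true_of_mem]
  intro k hk
  exact (Finset.mem_Ico.1 hk).2.trans_le h

theorem weight_le (hlam : ∀ n, 0 < lam n) (hε : 0 ≤ ε) (n : ℕ+) :
    weight lam ε a b n ≤ ε * ∑ k ∈ Finset.Ico b a, 1 / lam k := by
  refine mul_le_mul_of_nonneg_left ?_ hε
  exact Finset.sum_le_sum_of_subset_of_nonneg (Finset.filter_subset _ _)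
    fun k _ _ => (one_div_pos.2 (hlam k)).le

theorem weight_succ_sub (n : ℕ+) : weight lam ε a b (n + 1) - weight lam ε a b n =
    if n ∈ Finset.Ico b a then ε / lam n else 0 := by
  rw [weight, weight, ← mul_sub, Finset.sum_filter, Finset.sum_filter, ← Finset.sum_sub_distrib]
  have : ∀ k ∈ Finset.Ico b a, (((if k < n + 1 then 1 / lam k else 0) -
      if k < n then 1 / lam k else 0) : ℝ) = if n = k then 1 / lam k else 0 := by
    intro k _
    simp only [PNat.lt_add_one_iff]
    rcases lt_trichotomy k n with h | h | h
    · rw [if_pos h.le, if_pos h, if_neg h.ne', sub_self]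
    · simp [h]
    · rw [if_neg h.not_ge, if_neg h.not_gt, if_neg h.ne, sub_self]
  rw [Finset.sum_congr rfl this, Finset.sum_ite_eq]
  split_ifs <;> ring

theorem weight_succ_sub_nonneg (hlam : ∀ n, 0 < lam n) (hε : 0 ≤ ε) (n : ℕ+) :
    0 ≤ weight lam ε a b (n + 1) - weight lam ε a b n := by
  rw [weight_succ_sub]
  split_ifs
  · exact div_nonneg hε (hlam n).le
  · exact le_rfl

theorem weight_succ_sub_le (hlam : ∀ n, 0 < lam n) (hε : 0 ≤ ε) (n : ℕ+) :
    weight lam ε a b (n + 1) - weight lam ε a b n ≤ ε / lam n := by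
  rw [weight_succ_sub]
  split_ifs
  · exact le_rfl
  · exact div_nonneg hε (hlam n).le

end Weight

theorem norm_chi_resolvent_chi_le {lam q : ℕ+ → ℝ} (hsa : IsSelfAdjoint (jacobi lam q)) {r s c : ℝ}
    (hc : 0 < c) (hclam : ∀ n, c ≤ lam n)
    (hgap : ∀ x ∈ Set.Ioo r s, (x : ℂ) ∉ spectrum (jacobi lam q)) {l δ ε : ℝ}
    (hr : r < l) (hs : l < s) (hδ : |δ| ≤ Real.sqrt ((l - r) * (s - l)) / 8)
    (hε0 : 0 ≤ ε) (hεc : ε ≤ c) (hε1 : ε ^ 2 / c ≤ min (l - r) (s - l) / 8)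
    (hε2 : 2 * ε ≤ Real.sqrt ((l - r) * (s - l)) / 16) {R : Seq2 →L[ℂ] Seq2}
    (hR : IsResolventAt (jacobi lam q) ((l : ℂ) + δ * Complex.I) R) {A B : Set ℕ+} {a b : ℕ+}
    (ha : a ∈ lowerBounds A) (hb : b ∈ upperBounds B) :
    ‖chi A ∘L R ∘L chi B‖ ≤ 4 * max (l - r)⁻¹ (s - l)⁻¹ *
      Real.exp (-(ε * ∑ k ∈ Finset.Ico b a, 1 / lam k)) := by
  have hlam : ∀ n, 0 < lam n := fun n => hc.trans_le (hclam n)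
  have hm : 0 < min (l - r) (s - l) := lt_min (by linarith) (by linarith)
  have hmax : max (l - r)⁻¹ (s - l)⁻¹ = (min (l - r) (s - l))⁻¹ := by
    rcases le_total (l - r) (s - l) with h | h
    · rw [min_eq_left h, max_eq_left (inv_anti₀ (by linarith) h)]
    · rw [min_eq_right h, max_eq_right (inv_anti₀ (by linarith) h)]
  rw [hmax]
  refine ContinuousLinearMap.opNorm_le_bound _ (by positivity) fun v => ?_
  obtain ⟨hu, he⟩ := hR.1 (chi B v)
  set u := R (chi B v) with hu_def
  change ‖chi A u‖ ≤ _
  set M := ε * ∑ k ∈ Finset.Ico b a, 1 / lam k with hM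
  set F := weight lam ε a b with hF
  -- Stopping the growth of `F` at `a` keeps it bounded, so `e^F u` stays in `ℓ²`.
  let f : Seq2 := ⟨_, memlp_exp_mul (weight_le a b hlam hε0) u⟩
  have hf : ∀ n, f n = (Real.exp (F n) : ℂ) * u n := fun n => rfl
  have hB : ∀ n, (Real.exp (F n) : ℂ) * chi B v n = chi B v n := by
    intro n
    rw [chi_apply]
    by_cases hn : n ∈ B
    · rw [hF, weight_of_le a b (hb hn)]; simp
    · simp [hn]
  have hg : ∀ n, (chi B v + ((l : ℂ) + δ * Complex.I) • f) n =
      (Real.exp (F n) : ℂ) * jacobiExpr lam q u n := by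
    intro n
    have h1 : jacobiExpr lam q u n - ((l : ℂ) + δ * Complex.I) * u n = chi B v n :=
      congrArg (fun x : Seq2 => x n) he
    change chi B v n + ((l : ℂ) + δ * Complex.I) * f n = _
    rw [hf, ← hB, ← h1]
    ring
  have hinc0 := weight_succ_sub_nonneg a b hlam hε0
  have hinc := weight_succ_sub_le a b hlam hε0
  obtain ⟨hfD, hconj⟩ := jacobi_conj_exp lam q F
    (fun n => abs_mul_cosh_sub_one_le hc (hclam n) (hinc0 n) (hinc n) hεc)
    (fun n => abs_mul_sinh_le hc (hclam n) (hinc0 n) (hinc n) hεc) hf hg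
  have hest := quarter_min_mul_norm_le hsa hr hs hgap hδ
    ((norm_backShift_le fun n =>
      abs_mul_cosh_sub_one_le hc (hclam n) (hinc0 n) (hinc n) hεc).trans hε1)
    ((norm_backShift_le fun n =>
      abs_mul_sinh_le hc (hclam n) (hinc0 n) (hinc n) hεc).trans hε2) ⟨f, hfD⟩
  simp only at hest
  -- The right side becomes `‖chi B v‖` with no exponential factor, since `F = 0` on `B`.
  rw [hconj, add_sub_cancel_right] at hest
  have hA : Real.exp M * ‖chi A u‖ ≤ ‖f‖ := by
    have h1 : ‖((Real.exp M : ℝ) : ℂ) • chi A u‖ = Real.exp M * ‖chi A u‖ := by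
      rw [norm_smul, Complex.norm_real, Real.norm_eq_abs, Real.abs_exp]
    rw [← h1]
    refine lp.norm_mono (by norm_num) fun n => ?_
    change ‖((Real.exp M : ℝ) : ℂ) * chi A u n‖ ≤ ‖f n‖
    rw [chi_apply, hf]
    by_cases hn : n ∈ A
    · rw [Set.indicator_of_mem hn, hF, weight_of_ge a b (ha hn)]
    · rw [Set.indicator_of_notMem hn, mul_zero, norm_zero]; positivity
  have h2 := hest.trans (norm_chi_le B v)
  have h3 : min (l - r) (s - l) / 4 * (Real.exp M * ‖chi A u‖) ≤ ‖v‖ :=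
    (mul_le_mul_of_nonneg_left hA (by positivity)).trans h2
  rw [Real.exp_neg]
  calc ‖chi A u‖ = 4 * (min (l - r) (s - l))⁻¹ * (Real.exp M)⁻¹ *
        (min (l - r) (s - l) / 4 * (Real.exp M * ‖chi A u‖)) := by
        field_simp
    _ ≤ _ := by gcongr

end JacobiDecay

end

/-! ### Choice of the constant. -/

theorem theorem2p4 (lam q : ℕ+ → ℝ) (hlam : ∀ n, 0 < lam n)
    (hsa : IsSelfAdjoint (JacobiDecay.jacobi lam q))
    (hliminf : 0 < Filter.liminf (fun n : ℕ+ => (lam n : EReal)) Filter.atTop)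
    (r s : ℝ) (hrs : r < s)
    (hgap : ∀ x ∈ Set.Ioo r s, (x : ℂ) ∉ JacobiDecay.spectrum (JacobiDecay.jacobi lam q)) :
    ∃ η : ℝ, 0 < η ∧
      ∀ l ∈ Set.Ioo r s, ∀ δ : ℝ, |δ| ≤ Real.sqrt ((l - r) * (s - l)) / 8 →
        (l : ℂ) + δ * Complex.I ∈ JacobiDecay.resolventSet (JacobiDecay.jacobi lam q) ∧
        ∀ (A B : Set ℕ+) (a b : ℕ+), IsLeast A a → IsGreatest B b → b < a →
          ‖JacobiDecay.chi A ∘L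
              JacobiDecay.resolvent (JacobiDecay.jacobi lam q) ((l : ℂ) + δ * Complex.I) ∘L
              JacobiDecay.chi B‖
            ≤ 4 * max (l - r)⁻¹ (s - l)⁻¹ *
              Real.exp (-η * Real.sqrt ((l - r) * (s - l)) *
                ∑ k ∈ Finset.Ico b a, 1 / lam k) := by
  obtain ⟨c, hc, hclam⟩ := JacobiDecay.exists_pos_le_of_liminf_pos hlam hliminf
  have hsr : 0 < s - r := sub_pos.2 hrs
  -- For `ε = ηD`, the bound `1/32` gives `2ε ≤ D/16`, and `η (s - r) ≤ c` gives `ε ≤ c` because `D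
  -- ≤ s - r`. Together with `D² ≤ m (s - r)` they yield `ε² / c ≤ η m ≤ m/8`.
  obtain ⟨η, hη0, hη1, hη2⟩ : ∃ η : ℝ, 0 < η ∧ η ≤ 1 / 32 ∧ η * (s - r) ≤ c :=
    ⟨min (1 / 32) (c / (s - r)), lt_min (by norm_num) (by positivity), min_le_left _ _,
      (le_div_iff₀ hsr).1 (min_le_right _ _)⟩
  refine ⟨η, hη0, fun l hl δ hδ => ?_⟩
  obtain ⟨hr, hs⟩ := hl
  have hreal : (l : ℂ) ∈ JacobiDecay.resolventSet (JacobiDecay.jacobi lam q) := by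
    simpa [JacobiDecay.spectrum] using hgap l ⟨hr, hs⟩
  have hz := JacobiDecay.mem_resolventSet_of_real hsa hreal δ
  refine ⟨hz, fun A B a b ha hb _ => ?_⟩
  have hlr : 0 < l - r := sub_pos.2 hr
  have hsl : 0 < s - l := sub_pos.2 hs
  set D := Real.sqrt ((l - r) * (s - l)) with hD
  have hD0 : 0 ≤ D := Real.sqrt_nonneg _
  have hDsq : D ^ 2 = (l - r) * (s - l) := Real.sq_sqrt (by positivity)
  have hDle : D ≤ s - r := Real.sqrt_le_iff.2 ⟨hsr.le, by nlinarith⟩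
  have hDmin : D ^ 2 ≤ min (l - r) (s - l) * (s - r) := by
    rw [hDsq]
    rcases min_choice (l - r) (s - l) with h | h <;> rw [h] <;> nlinarith
  have hmin : 0 < min (l - r) (s - l) := lt_min hlr hsl
  have h := JacobiDecay.norm_chi_resolvent_chi_le hsa hc hclam hgap (ε := η * D) hr hs hδ
    (by positivity) ((mul_le_mul_of_nonneg_left hDle hη0.le).trans hη2)
    (by
      rw [div_le_iff₀ hc]
      calc (η * D) ^ 2 = η * η * D ^ 2 := by ring
        _ ≤ η * η * (min (l - r) (s - l) * (s - r)) := by gcongr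
        _ = min (l - r) (s - l) * η * (η * (s - r)) := by ring
        _ ≤ min (l - r) (s - l) * (1 / 8) * c := by
          gcongr
          linarith
        _ = min (l - r) (s - l) / 8 * c := by ring)
    (by
      rw [← hD]
      have := mul_le_mul_of_nonneg_right hη1 hD0
      linarith)
    (JacobiDecay.isResolventAt_resolvent hz) ha.2 hb.2
  refine h.trans_eq ?_
  congr 2
  ring
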